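/- **Model.** There are $n$ parties, at most $f$ of them Byzantine (arbitrary, colluding); the others are honest. Digital signatures are ideal: a signature of an honest party occurs in a message only after that party has made it. $\langle m\rangle_i$ denotes $m$ signed by party $i$. All parties start at time $0$ with equal clocks (synchronized start) and know a bound $\Delta>0$. In an execution with actual delay bound $\delta\le\Delta$ (unknown to the parties), each message between honest parties is delayed by an adversarially chosen amount in $[0,\delta]$; messages from or to Byzantine parties have arbitrary, possibly infinite, delay. Protocols are deterministic. A protocol *solves Byzantine broadcast* with broadcaster $L$ tolerating $f$ faults if in all such executions: (agreement) honest parties never commit different values; (validity) if $L$ is honest, all honest parties commit the input of $L$ and terminate; (termination) all honest parties commit and terminate. A protocol *solves Byzantine agreement* (BA), where every party has an input, if the same agreement and termination hold and, whenever all honest parties have the same input, they all commit it. Inputs of the broadcaster come from a set $V$ with at least two elements; inputs to the BA, and committed values, lie in $V\cup\{\bot\}$. A broadcast protocol has *good-case latency* $T$ for actual delay bound $\delta$ if in every execution with that bound in which $L$ is honest, all honest parties commit within time $T$. **The $(\Delta+\delta)$-BB protocol**, given a BA protocol. Initially each party $i$ has $\mathrm{lock}=\bot$ and $\mathrm{rank}=\Delta+1$.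 1. *Propose.* At time $0$, $L$ with input $v$ sends $\langle \mathrm{propose},v\rangle_L$ to all parties. 2. *Vote.* When the first valid proposal $\langle \mathrm{propose},v\rangle_L$ arrives from $L$, at time $d\le\Delta$, party $i$ sends $\langle \mathrm{vote},d,\langle \mathrm{propose},v\rangle_L\rangle_i$ to all parties. 3. *Commit and lock.* For any $t\in[0,\Delta]$: if within time $t+\Delta$ party $i$ has received no two messages containing different values signed by $L$, and has received votes for the same value $v$ signed by $f+1$ different parties, each with $d\le t$, then at time $t+\Delta$ it commits $v$ and forwards these votes to all parties. For any $t\in[0,\Delta]$: if within time $2\Delta+t$ it receives votes for the same value $v$ signed by $f+1$ different parties, each with $d\le t$, and $\mathrm{rank}>t$, it sets $\mathrm{lock}=v$ and $\mathrm{rank}=t$. 4. *Byzantine agreement.* At time $4\Delta$ it invokes the BA protocol with input $\mathrm{lock}$. If it has not committed, it commits the output of the BA. It terminates when the BA does. **Theorem.** Let $n/3<f<n/2$. If the BA protocol solves Byzantine agreement tolerating $f$ faults under synchronized start, then the $(\Delta+\delta)$-BB protocol solves Byzantine broadcast tolerating $f$ faults under synchronized start, and it has good-case latency $\Delta+\delta$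 for every actual delay bound $\delta\in[0,\Delta]$. This is optimal: if any deterministic authenticated protocol solves Byzantine broadcast tolerating $f$ faults under synchronized start and has good-case latency $T$ for some actual delay bound $\delta\in(0,\Delta]$, then $T\ge\Delta+\delta$. -/

import Mathlib

open Set

universe u w w₁ w₂

namespace ByzantineBroadcast

/-! ### Model: deterministic authenticated protocols, real time, synchronized start -/

/-- The receipt of a message: when it arrives, over whose channel, and its content. -/
structure Delivery (n : ℕ) (M : Type w) where
  time : ℝ
  sender : Fin n
  msg : M

/-- What a party has received. -/
abbrev History (n : ℕ) (M : Type w) := Set (Delivery n M)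

/-- The part of a history up to and including time `t`. -/
def History.upTo {n : ℕ} {M : Type w} (h : History n M) (t : ℝ) : History n M :=
  {e | e ∈ h ∧ e.time ≤ t}

/-- A deterministic authenticated protocol for `n` parties. All the actions of party `i` with input
`x` at time `t` are functions of `i`, `x`, `t` and its history up to time `t`. A message may contain
signatures: `(k, s) ∈ signatures m` says that `m` contains the statement `s` signed by party `k`. -/
structure Protocol (n : ℕ) (In : Type w₁) (Out : Type w₂) where
  /-- messages -/
  Msg : Type w
  /-- statements that parties can sign -/
  Stmt : Type w
  /-- the signatures contained in a message -/
  signatures : Msg → Set (Fin n × Stmt)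
  /-- the statements signed at time `t` -/
  sign : Fin n → In → ℝ → History n Msg → Set Stmt
  /-- the messages sent at time `t` to a given party -/
  send : Fin n → In → ℝ → History n Msg → Fin n → Set Msg
  /-- the values committed at time `t` -/
  commit : Fin n → In → ℝ → History n Msg → Set Out
  /-- whether the party terminates at time `t` -/
  halt : Fin n → In → ℝ → History n Msg → Prop
  /-- The protocol does not ask parties to forge signatures: a signature in a message sent by `i` at
  time `t` is `i`'s own and made by then, or it was contained in a message received by then. -/
  no_forge : ∀ (i : Fin n) (x : In) (t : ℝ) (h : History n Msg) (j : Fin n) (m : Msg),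
    0 ≤ t → (∀ e ∈ h, e.time ≤ t) → m ∈ send i x t h j → ∀ k s, (k, s) ∈ signatures m →
      (k = i ∧ ∃ t', 0 ≤ t' ∧ t' ≤ t ∧ s ∈ sign i x t' (h.upTo t')) ∨
        ∃ e ∈ h, (k, s) ∈ signatures e.msg

/-- The data of an execution: which parties are honest (the others are Byzantine), which messages
each party sends at which time to which party, and the delay of each message. A message that never
reaches an honest party from a Byzantine one (infinite delay) is one that is not sent. -/
structure Run (n : ℕ) (M : Type w) where
  honest : Finset (Fin n)
  sent : Fin n → ℝ → Fin n → Set M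
  delay : Fin n → Fin n → ℝ → M → ℝ

/-- What party `j` has received up to and including time `t`. -/
def Run.history {n : ℕ} {M : Type w} (R : Run n M) (j : Fin n) (t : ℝ) : History n M :=
  {e | e.time ≤ t ∧
    ∃ s, e.msg ∈ R.sent e.sender s j ∧ e.time = s + R.delay e.sender j s e.msg}

namespace Protocol

variable {n : ℕ} {In : Type w₁} {Out : Type w₂}

/-- Party `i`, following the protocol, has not terminated before time `t`. -/
def Active (P : Protocol.{w} n In Out) (input : Fin n → In) (R : Run n P.Msg)
    (i : Fin n) (t : ℝ) : Prop :=
  ∀ t', 0 ≤ t' → t' < t → ¬ P.halt i (input i) t' (R.history i t')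

/-- Party `i`, following the protocol, signs the statement `s` at time `t`. -/
def Signs (P : Protocol.{w} n In Out) (input : Fin n → In) (R : Run n P.Msg)
    (i : Fin n) (t : ℝ) (s : P.Stmt) : Prop :=
  0 ≤ t ∧ P.Active input R i t ∧ s ∈ P.sign i (input i) t (R.history i t)

/-- Party `i`, following the protocol, commits the value `x` at time `t`. -/
def Commits (P : Protocol.{w} n In Out) (input : Fin n → In) (R : Run n P.Msg)
    (i : Fin n) (t : ℝ) (x : Out) : Prop :=
  0 ≤ t ∧ P.Active input R i t ∧ x ∈ P.commit i (input i) t (R.history i t)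

/-- Party `i`, following the protocol, terminates at time `t`. -/
def Terminates (P : Protocol.{w} n In Out) (input : Fin n → In) (R : Run n P.Msg)
    (i : Fin n) (t : ℝ) : Prop :=
  0 ≤ t ∧ P.Active input R i t ∧ P.halt i (input i) t (R.history i t)

/-- `R` is an execution of the protocol `P` with inputs `input`, at most `f` Byzantine parties and
actual delay bound `δ`, in which all parties start at time `0`. -/
structure IsExecution (P : Protocol.{w} n In Out) (f : ℕ) (δ : ℝ) (input : Fin n → In)
    (R : Run n P.Msg) : Prop where
  faulty_le : R.honestᶜ.card ≤ f
  sent_nonneg : ∀ i t j m, m ∈ R.sent i t j → 0 ≤ t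
  /-- honest parties follow the protocol until they terminate -/
  honest_sent : ∀ i ∈ R.honest, ∀ t j, R.sent i t j =
    {m | 0 ≤ t ∧ P.Active input R i t ∧ m ∈ P.send i (input i) t (R.history i t) j}
  delay_nonneg : ∀ i t j m, m ∈ R.sent i t j → 0 ≤ R.delay i j t m
  /-- messages between honest parties take at most `δ` -/
  delay_le : ∀ i ∈ R.honest, ∀ j ∈ R.honest, ∀ t m, m ∈ R.sent i t j → R.delay i j t m ≤ δ
  /-- ideal signatures: an honest party's signature occurs only after that party has made it -/
  unforgeable : ∀ i t j m, m ∈ R.sent i t j → ∀ k ∈ R.honest, ∀ s, (k, s) ∈ P.signatures m →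
    ∃ t' ≤ t, P.Signs input R k t' s

end Protocol

/-! ### Byzantine broadcast, good-case latency, Byzantine agreement

The values are the elements of `V`; parties may also commit the default value `⊥`, which is
`none : Option V`. -/

/-- In a broadcast only the broadcaster `L` has an input. -/
def broadcastInput {n : ℕ} {V : Type u} (L : Fin n) (v : V) (i : Fin n) : Option V :=
  if i = L then some v else none

namespace Protocol

variable {n : ℕ} {V : Type u}

/-- The protocol solves Byzantine broadcast with broadcaster `L`, tolerating `f` faults, under
synchronized start and known delay bound `Δ` (the actual delay bound `δ ≤ Δ` is arbitrary). -/
def SolvesBB (P : Protocol.{w} n (Option V) (Option V)) (L : Fin n) (f : ℕ) (Δ : ℝ) : Prop :=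
  ∀ (v : V) (δ : ℝ) (R : Run n P.Msg), 0 ≤ δ → δ ≤ Δ →
    P.IsExecution f δ (broadcastInput L v) R →
    -- agreement
    (∀ i ∈ R.honest, ∀ j ∈ R.honest, ∀ t t' x x', P.Commits (broadcastInput L v) R i t x →
      P.Commits (broadcastInput L v) R j t' x' → x = x') ∧
    -- validity
    (L ∈ R.honest → ∀ i ∈ R.honest, (∃ t, P.Commits (broadcastInput L v) R i t (some v)) ∧
      ∃ t, P.Terminates (broadcastInput L v) R i t) ∧
    -- termination
    (∀ i ∈ R.honest, (∃ t x, P.Commits (broadcastInput L v) R i t x) ∧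
      ∃ t, P.Terminates (broadcastInput L v) R i t)

/-- In every execution with actual delay bound `δ` and honest broadcaster, all honest parties commit
within time `T` (counted from the common start of the parties). -/
def HasGoodCaseLatency (P : Protocol.{w} n (Option V) (Option V)) (L : Fin n) (f : ℕ)
    (δ T : ℝ) : Prop :=
  ∀ (v : V) (R : Run n P.Msg), P.IsExecution f δ (broadcastInput L v) R → L ∈ R.honest →
    ∀ i ∈ R.honest, ∃ t x, t ≤ T ∧ P.Commits (broadcastInput L v) R i t x

/-- The protocol solves Byzantine agreement on `V ∪ {⊥}`, tolerating `f` faults, under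
synchronized start and known delay bound `Δ`. -/
def SolvesBA (P : Protocol.{w} n (Option V) (Option V)) (f : ℕ) (Δ : ℝ) : Prop :=
  ∀ (input : Fin n → Option V) (δ : ℝ) (R : Run n P.Msg), 0 ≤ δ → δ ≤ Δ →
    P.IsExecution f δ input R →
    -- agreement
    (∀ i ∈ R.honest, ∀ j ∈ R.honest, ∀ t t' x x', P.Commits input R i t x →
      P.Commits input R j t' x' → x = x') ∧
    -- validity
    (∀ x, (∀ i ∈ R.honest, input i = x) → ∀ i ∈ R.honest, ∃ t, P.Commits input R i t x) ∧
    -- termination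
    (∀ i ∈ R.honest, (∃ t x, P.Commits input R i t x) ∧ ∃ t, P.Terminates input R i t)

end Protocol

/-! ### The `(Δ + δ)`-BB protocol -/

/-- `⟨propose, value⟩_signer` -/
structure Proposal (n : ℕ) (V : Type u) where
  signer : Fin n
  value : V

/-- `⟨vote, time, proposal⟩_signer` -/
structure Vote (n : ℕ) (V : Type u) where
  signer : Fin n
  time : ℝ
  proposal : Proposal n V

/-- Messages of the broadcast protocol; `ba` wraps the messages of the agreement instance. -/
inductive BBMsg (n : ℕ) (V : Type u) (M : Type w) : Type (max u w)
  | propose (p : Proposal n V)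
  | vote (a : Vote n V)
  | ba (m : M)

/-- Signed statements of the broadcast protocol; `ba` wraps those of the agreement instance. -/
inductive BBStmt (n : ℕ) (V : Type u) (S : Type w) : Type (max u w)
  | propose (v : V)
  | vote (d : ℝ) (p : Proposal n V)
  | ba (s : S)

/-- The signatures contained in a message, including the nested ones. -/
def bbSignatures {n : ℕ} {V : Type u} {M S : Type w} (sig : M → Set (Fin n × S)) :
    BBMsg n V M → Set (Fin n × BBStmt n V S)
  | .propose p => {(p.signer, .propose p.value)}
  | .vote a => {(a.signer, .vote a.time a.proposal), (a.proposal.signer, .propose a.proposal.value)}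
  | .ba m => {q | ∃ s, (q.1, s) ∈ sig m ∧ q.2 = .ba s}

section Rules

variable {n : ℕ} {V : Type u} {M : Type w}

/-- A proposal `⟨propose, v⟩_L` is received from the broadcaster `L` at time `d`, and none is
received from it before. -/
def FirstProposal (L : Fin n) (h : History n (BBMsg n V M)) (d : ℝ) (v : V) : Prop :=
  ⟨d, L, .propose ⟨L, v⟩⟩ ∈ h ∧ ∀ d' v', ⟨d', L, .propose ⟨L, v'⟩⟩ ∈ h → d ≤ d'

/-- `v` is the value of the first proposal, received at time `d`. Of several first proposals that
arrive simultaneously the party takes one, by a fixed rule. -/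
def VotesFor (L : Fin n) (h : History n (BBMsg n V M)) (d : ℝ) (v : V) : Prop :=
  ∃ hv : ∃ v', FirstProposal L h d v', v = hv.choose

/-- The message `m` contains `⟨propose, v⟩_L`. -/
def ContainsValue (L : Fin n) (v : V) : BBMsg n V M → Prop
  | .propose p => p = ⟨L, v⟩
  | .vote a => a.proposal = ⟨L, v⟩
  | .ba _ => False

/-- The party detects equivocation within time `s`: by then it has received messages that contain
different values signed by the broadcaster. -/
def Equivocation (L : Fin n) (h : History n (BBMsg n V M)) (s : ℝ) : Prop :=
  ∃ v v' : V, v ≠ v' ∧ (∃ e ∈ h.upTo s, ContainsValue L v e.msg) ∧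
    ∃ e ∈ h.upTo s, ContainsValue L v' e.msg

/-- Within time `s` the party receives, directly or forwarded, the vote `a`, and `a` is a vote for
`v` with time stamp in `[0, t]`. -/
def ReceivesVote (L : Fin n) (h : History n (BBMsg n V M)) (v : V) (t s : ℝ) (a : Vote n V) :
    Prop :=
  a.proposal = ⟨L, v⟩ ∧ 0 ≤ a.time ∧ a.time ≤ t ∧ ∃ e ∈ h.upTo s, e.msg = .vote a

/-- Within time `s` the party receives votes for `v` with time stamps in `[0, t]` that are signed by
`f + 1` different parties. -/
def ReceivesVotes (L : Fin n) (f : ℕ) (h : History n (BBMsg n V M)) (v : V) (t s : ℝ) : Prop :=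
  ∃ Q : Finset (Fin n), Q.card = f + 1 ∧ ∀ k ∈ Q, ∃ a, a.signer = k ∧ ReceivesVote L h v t s a

/-- The commit rule for the parameter `t ∈ [0, Δ]`, evaluated at time `t + Δ`. -/
def CommitRule (L : Fin n) (f : ℕ) (Δ : ℝ) (h : History n (BBMsg n V M)) (t : ℝ) (v : V) : Prop :=
  t ∈ Icc 0 Δ ∧ ¬ Equivocation L h (t + Δ) ∧ ReceivesVotes L f h v t (t + Δ)

/-- The votes condition of the lock rule for the parameter `t ∈ [0, Δ]` and the value `v` holds at a
time `s ≤ 2Δ + t`. The rule sets `lock = v` and `rank = t` if moreover `rank > t` at that time. -/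
def LockRule (L : Fin n) (f : ℕ) (Δ : ℝ) (h : History n (BBMsg n V M)) (v : V) (t s : ℝ) : Prop :=
  t ∈ Icc 0 Δ ∧ s ≤ 2 * Δ + t ∧ ReceivesVotes L f h v t s

/-- The applications of the lock rule leave the party with `lock = v`. As an update lowers the rank
strictly (from the initial rank `Δ + 1`, which is above every `t`), the last update is to a value
whose rank is lowest, and among values of the same rank to the one that reaches it first. -/
def LocksOn (L : Fin n) (f : ℕ) (Δ : ℝ) (h : History n (BBMsg n V M)) (v : V) : Prop :=
  ∃ t s, LockRule L f Δ h v t s ∧ ∀ v' t' s', v' ≠ v → LockRule L f Δ h v' t' s' →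
    t < t' ∨ (t = t' ∧ s ≤ s')

open Classical in
/-- The lock of a party with history `h`; it is `⊥` if no update took place. Between updates to
different values that are simultaneous and of the same rank the party decides by a fixed rule. -/
noncomputable def lock (L : Fin n) (f : ℕ) (Δ : ℝ) (h : History n (BBMsg n V M)) : Option V :=
  if hv : ∃ v, LocksOn L f Δ h v then some hv.choose else none

/-- The messages of the agreement instance, which starts at time `4Δ`, on the clock of that
instance; anything received before it starts is discarded. -/
def baHistory (Δ : ℝ) (h : History n (BBMsg n V M)) : History n M :=
  {e | 0 ≤ e.time ∧ ⟨e.time + 4 * Δ, e.sender, .ba e.msg⟩ ∈ h}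

end Rules

theorem History.upTo_upTo {n : ℕ} {M : Type w} (h : History n M) {s t : ℝ} (hst : s ≤ t) :
    (h.upTo t).upTo s = h.upTo s := by
  ext e
  constructor
  · rintro ⟨⟨h1, _⟩, h3⟩
    exact ⟨h1, h3⟩
  · rintro ⟨h1, h3⟩
    exact ⟨⟨h1, h3.trans hst⟩, h3⟩

theorem History.upTo_eq {n : ℕ} {M : Type w} (h : History n M) {t : ℝ}
    (ht : ∀ e ∈ h, e.time ≤ t) : h.upTo t = h := by
  ext e
  exact ⟨fun he => he.1, fun he => ⟨he, ht e he⟩⟩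

theorem baHistory_upTo {n : ℕ} {V : Type u} {M : Type w} (Δ : ℝ) (h : History n (BBMsg n V M))
    (t : ℝ) : (baHistory Δ h).upTo t = baHistory Δ (h.upTo (t + 4 * Δ)) := by
  ext e
  constructor
  · rintro ⟨⟨h1, h2⟩, h3⟩
    exact ⟨h1, h2, by simpa using h3⟩
  · rintro ⟨h1, h2, h3⟩
    exact ⟨⟨h1, h2⟩, by simpa using h3⟩

/-- The `(Δ + δ)`-BB protocol with broadcaster `L` for `f` faults, which uses the Byzantine agreement
protocol `A`. At time `t`, a party `i` with input `x` and history `h`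
* (propose) if it is the broadcaster and `t = 0`: sends `⟨propose, v⟩_L` to all, where `x = v`;
* (vote) if the first valid proposal arrives and `t ≤ Δ`: sends `⟨vote, t, ⟨propose, v⟩_L⟩_i` to all;
* (commit) if the commit rule holds for `v` with the parameter `t - Δ`: commits `v` and forwards the
  votes for `v` on which this is based to all;
* (agreement) if `t ≥ 4Δ`: runs `A`, started at time `4Δ` with its lock as input; it commits the
  output of `A` if it has not committed before, and terminates when `A` does. -/
noncomputable def bbProtocol {n : ℕ} {V : Type u} (L : Fin n) (f : ℕ) (Δ : ℝ)
    (hΔ : 0 < Δ) (A : Protocol.{w} n (Option V) (Option V)) :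
    Protocol.{max u w} n (Option V) (Option V) where
  Msg := BBMsg n V A.Msg
  Stmt := BBStmt n V A.Stmt
  signatures := bbSignatures A.signatures
  sign i x t h :=
    {s | (i = L ∧ t = 0 ∧ ∃ v, x = some v ∧ s = .propose v) ∨
      (t ≤ Δ ∧ ∃ v, VotesFor L h t v ∧ s = .vote t ⟨L, v⟩) ∨
      (4 * Δ ≤ t ∧ ∃ s', s = .ba s' ∧
        s' ∈ A.sign i (lock L f Δ (h.upTo (4 * Δ))) (t - 4 * Δ) (baHistory Δ h))}
  send i x t h j :=
    {m | (i = L ∧ t = 0 ∧ ∃ v, x = some v ∧ m = .propose ⟨L, v⟩) ∨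
      (t ≤ Δ ∧ ∃ v, VotesFor L h t v ∧ m = .vote ⟨i, t, ⟨L, v⟩⟩) ∨
      (∃ v, CommitRule L f Δ h (t - Δ) v ∧
        ∃ a, ReceivesVote L h v (t - Δ) t a ∧ m = .vote a) ∨
      (4 * Δ ≤ t ∧ ∃ m', m = .ba m' ∧
        m' ∈ A.send i (lock L f Δ (h.upTo (4 * Δ))) (t - 4 * Δ) (baHistory Δ h) j)}
  commit i _ t h :=
    {y | (∃ v, CommitRule L f Δ h (t - Δ) v ∧ y = some v) ∨
      (4 * Δ ≤ t ∧ (¬ ∃ t' v, CommitRule L f Δ h t' v) ∧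
        y ∈ A.commit i (lock L f Δ (h.upTo (4 * Δ))) (t - 4 * Δ) (baHistory Δ h))}
  halt i _ t h :=
    4 * Δ ≤ t ∧ A.halt i (lock L f Δ (h.upTo (4 * Δ))) (t - 4 * Δ) (baHistory Δ h)
  no_forge := by
    intro i x t h j m ht0 hht hm k s hs
    rcases hm with ⟨rfl, rfl, v, rfl, rfl⟩ | ⟨htΔ, v, hv, rfl⟩ | ⟨v, -, a, ⟨-, -, -, e, he, hea⟩, rfl⟩ |
      ⟨ht, m', rfl, hm'⟩
    · simp only [bbSignatures, mem_singleton_iff, Prod.mk.injEq] at hs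
      obtain ⟨rfl, rfl⟩ := hs
      exact Or.inl ⟨rfl, 0, le_rfl, le_rfl, Or.inl ⟨rfl, rfl, v, rfl, rfl⟩⟩
    · simp only [bbSignatures, mem_insert_iff, mem_singleton_iff, Prod.mk.injEq] at hs
      rcases hs with ⟨rfl, rfl⟩ | ⟨rfl, rfl⟩
      · refine Or.inl ⟨rfl, t, ht0, le_rfl, Or.inr (Or.inl ⟨htΔ, v, ?_, rfl⟩)⟩
        rwa [History.upTo_eq h hht]
      · obtain ⟨hv, rfl⟩ := hv
        exact Or.inr ⟨_, hv.choose_spec.1, rfl⟩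
    · exact Or.inr ⟨e, he.1, by rw [hea]; exact hs⟩
    · obtain ⟨s', hs', hs''⟩ := hs
      simp only at hs' hs''
      subst hs''
      have hb : ∀ e ∈ baHistory Δ h, e.time ≤ t - 4 * Δ := by
        intro e he
        have := hht _ he.2
        simp only at this
        linarith
      rcases A.no_forge i _ (t - 4 * Δ) (baHistory Δ h) j m' (by linarith) hb hm' k s' hs' with
        ⟨rfl, t', ht'0, ht't, hsig⟩ | ⟨e, he, hes⟩
      · refine Or.inl ⟨rfl, t' + 4 * Δ, by linarith, by linarith,
          Or.inr (Or.inr ⟨by linarith, s', rfl, ?_⟩)⟩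
        rw [History.upTo_upTo h (by linarith), add_sub_cancel_right, ← baHistory_upTo]
        exact hsig
      · exact Or.inr ⟨_, he.2, s', hes, rfl⟩

end ByzantineBroadcast

/-!
The protocol is correct because an honest vote reaches all honest parties within `Δ`. Among the
signers of `f + 1` votes there is an honest one, so if an honest party sees `f + 1` votes for `v'`
with time stamps up to `t`, then every honest party has seen `v'` by time `t + Δ`; a party that
commits `v` at that time has seen no other value (`CommitRule.eq_of_receivesVotes`). Hence direct
commits agree (`CommitRule.unique`). The votes forwarded by a party that commits `v` directly lock
all honest parties on `v`, since no other value can reach as low a rank (`CommitRule.lockInput_eq`),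
and then the agreement instance outputs `v` by its validity. The properties of the agreement protocol
can be used because a run of the broadcast protocol contains an execution of it, on the clock that
starts at `4Δ` (`baRun_isExecution`). If the broadcaster is honest, all honest parties vote within
`δ`, these votes arrive within `2δ ≤ Δ + δ`, and the commit rule with parameter `δ` applies
(`commitRule_of_honest`).

The lower bound is an indistinguishability argument. Let `A` and `C` be disjoint sets of `f` parties
without the broadcaster; at most `f` parties remain, since `n < 3f`. All messages take time `δ`, but
those between `A` and `C` take `Δ`. In the run `R₁` the broadcaster has input `v₁` and `C` is
Byzantine; it sends to `A` what it would send before having received anything, that is, before time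
`δ`, and is silent otherwise. The run `R₂` has the roles of `A` and `C` exchanged, and input `v₂`. In
a third run `A` and `C` are honest, and the other parties behave towards `A` as in `R₁` and towards
`C` as in `R₂`. What reaches `A` from `C` before `Δ + δ` was sent before `δ`, so until `Δ + δ` the
parties of `A` cannot tell this run from `R₁` (`IsSplit.history_eq`), nor those of `C` from `R₂`. If
the good-case latency were less than `Δ + δ`, they would commit `v₁` and `v₂`. The third run respects
the ideal signatures, because before time `Δ` no signature of `C` has reached the remaining parties
in `R₁` (`IsOneSided.signer_notMem`). The three runs exist since all their delays are at least
`δ > 0` (`Protocol.exists_run`).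
-/

namespace ByzantineBroadcast

/-! ### Histories and activity -/

theorem Run.history_upTo {n : ℕ} {M : Type w} (R : Run n M) (j : Fin n) {s t : ℝ} (hst : s ≤ t) :
    (R.history j t).upTo s = R.history j s := by
  ext e
  exact ⟨fun ⟨⟨_, h2⟩, h3⟩ => ⟨h3, h2⟩, fun ⟨h1, h2⟩ => ⟨⟨h1.trans hst, h2⟩, h1⟩⟩

theorem Protocol.Active.mono {n : ℕ} {In : Type w₁} {Out : Type w₂} {P : Protocol.{w} n In Out}
    {input : Fin n → In} {R : Run n P.Msg} {i : Fin n} {s t : ℝ} (h : P.Active input R i t)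
    (hst : s ≤ t) : P.Active input R i s :=
  fun t' h0 ht => h t' h0 (ht.trans_le hst)

/-- What a party does up to time `t` depends on its input and its view up to `t` only. -/
theorem Protocol.Active.congr {n : ℕ} {In : Type w₁} {Out : Type w₂} {P : Protocol.{w} n In Out}
    {x y : Fin n → In} {R R' : Run n P.Msg} {i : Fin n} {t : ℝ} (h : P.Active x R i t)
    (hxy : x i = y i) (hR : ∀ s < t, R.history i s = R'.history i s) : P.Active y R' i t :=
  fun t' h0 ht hh => h t' h0 ht (by rwa [hxy, hR t' ht])

/-! ### Executions with delays bounded below -/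

/-- Induction along the real line in steps of length `δ`. -/
theorem real_step_induction {δ : ℝ} (hδ : 0 < δ) {p : ℝ → Prop} (hneg : ∀ t < 0, p t)
    (hstep : ∀ t, (∀ s ≤ t - δ, p s) → p t) (t : ℝ) : p t := by
  have key : ∀ k : ℕ, ∀ t < k * δ, p t := by
    intro k
    induction k with
    | zero => simpa using hneg
    | succ k ih =>
      intro t ht
      refine hstep t fun s hs => ih s ?_
      push_cast at ht
      linarith
  obtain ⟨k, hk⟩ := exists_nat_gt (t / δ)
  exact key k t ((div_lt_iff₀ hδ).1 hk)

/-- If every delay on a channel to `j` is at least `δ`, the view of `j` at time `t` is determined by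
what was sent up to time `t - δ`. -/
theorem Run.history_congr {n : ℕ} {M : Type w} {R R' : Run n M} {D : Fin n → Fin n → ℝ}
    (hD : ∀ i j t m, R.delay i j t m = D i j) (hD' : ∀ i j t m, R'.delay i j t m = D i j)
    {j : Fin n} {t : ℝ} (h : ∀ i, ∀ s ≤ t - D i j, R.sent i s j = R'.sent i s j) :
    R.history j t = R'.history j t := by
  ext e
  constructor
  · rintro ⟨h1, s, h2, h3⟩
    rw [hD] at h3
    exact ⟨h1, s, by rwa [← h _ s (by linarith)], by rwa [hD']⟩
  · rintro ⟨h1, s, h2, h3⟩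
    rw [hD'] at h3
    exact ⟨h1, s, by rwa [h _ s (by linarith)], by rwa [hD]⟩

namespace Protocol

variable {n : ℕ} {In : Type w₁} {Out : Type w₂}

/-- The messages that are sent if the parties in `H` follow the protocol, the others send `byz`, and
every party has received what it would receive in a run in which `S` is sent. -/
def respond (P : Protocol.{w} n In Out) (input : Fin n → In) (H : Finset (Fin n))
    (byz : Fin n → ℝ → Fin n → Set P.Msg) (D : Fin n → Fin n → ℝ)
    (S : Fin n → ℝ → Fin n → Set P.Msg) (i : Fin n) (t : ℝ) (j : Fin n) : Set P.Msg :=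
  {m | (i ∈ H ∧ 0 ≤ t ∧ P.Active input ⟨H, S, fun i j _ _ => D i j⟩ i t ∧
      m ∈ P.send i (input i) t (Run.history ⟨H, S, fun i j _ _ => D i j⟩ i t) j) ∨
    (i ∉ H ∧ m ∈ byz i t j)}

theorem respond_congr (P : Protocol.{w} n In Out) (input : Fin n → In) (H : Finset (Fin n))
    (byz : Fin n → ℝ → Fin n → Set P.Msg) {D : Fin n → Fin n → ℝ} {δ : ℝ}
    (hD : ∀ i j, δ ≤ D i j) {S S' : Fin n → ℝ → Fin n → Set P.Msg} {c : ℝ}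
    (h : ∀ i, ∀ t < c, ∀ j, S i t j = S' i t j) :
    ∀ i, ∀ t < c + δ, ∀ j,
      P.respond input H byz D S i t j = P.respond input H byz D S' i t j := by
  intro i t ht j
  have hh : ∀ t < c + δ, Run.history ⟨H, S, fun i j _ _ => D i j⟩ i t =
      Run.history ⟨H, S', fun i j _ _ => D i j⟩ i t := fun t ht =>
    Run.history_congr (D := D) (fun _ _ _ _ => rfl) (fun _ _ _ _ => rfl)
      fun k s hs => h k s (by linarith [hD k i]) i
  have ha : P.Active input ⟨H, S, fun i j _ _ => D i j⟩ i t ↔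
      P.Active input ⟨H, S', fun i j _ _ => D i j⟩ i t :=
    ⟨fun hA => hA.congr rfl fun s hs => hh s (hs.trans ht),
      fun hA => hA.congr rfl fun s hs => (hh s (hs.trans ht)).symm⟩
  simp only [respond, ha, hh t ht]

/-- When all delays are at least `δ > 0`, what is sent before time `(k + 1) δ` depends on what is sent
before `k δ`; so there is a run for every behaviour of the Byzantine parties. -/
theorem exists_run (P : Protocol.{w} n In Out) (input : Fin n → In) (H : Finset (Fin n))
    (byz : Fin n → ℝ → Fin n → Set P.Msg) (hbyz : ∀ i t j m, m ∈ byz i t j → 0 ≤ t)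
    {D : Fin n → Fin n → ℝ} {δ : ℝ} (hδ : 0 < δ) (hD : ∀ i j, δ ≤ D i j) :
    ∃ R : Run n P.Msg, R.honest = H ∧ (∀ i j t m, R.delay i j t m = D i j) ∧
      (∀ i ∈ H, ∀ t j, R.sent i t j =
        {m | 0 ≤ t ∧ P.Active input R i t ∧ m ∈ P.send i (input i) t (R.history i t) j}) ∧
      ∀ i ∉ H, ∀ t j, R.sent i t j = byz i t j := by
  let S : ℕ → Fin n → ℝ → Fin n → Set P.Msg := fun k => (P.respond input H byz D)^[k] fun _ _ _ => ∅
  have hS : ∀ k, S (k + 1) = P.respond input H byz D (S k) := fun k =>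
    Function.iterate_succ_apply' _ _ _
  have h1 : ∀ k : ℕ, ∀ i, ∀ t < k * δ, ∀ j, S k i t j = S (k + 1) i t j := by
    intro k
    induction k with
    | zero =>
      intro i t ht j
      rw [hS]
      have ht : t < 0 := by simpa using ht
      ext m
      refine ⟨fun hm => hm.elim, ?_⟩
      rintro (⟨_, h0, _⟩ | ⟨_, hm⟩)
      · linarith
      · linarith [hbyz _ _ _ _ hm]
    | succ k ih =>
      intro i t ht j
      rw [hS (k + 1)]
      conv_lhs => rw [hS k]
      exact P.respond_congr input H byz hD ih i t (by push_cast at ht; linarith) j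
  have h2 : ∀ k l : ℕ, ∀ i, ∀ t < k * δ, ∀ j, S k i t j = S (k + l) i t j := by
    intro k l i t ht j
    induction l with
    | zero => rfl
    | succ l ih =>
      rw [ih, ← add_assoc]
      refine h1 (k + l) i t (ht.trans_le ?_) j
      push_cast
      nlinarith [Nat.cast_nonneg (α := ℝ) l]
  choose N hN using fun t : ℝ => exists_nat_gt (t / δ)
  have hN' : ∀ t, t < N t * δ := fun t => (div_lt_iff₀ hδ).1 (hN t)
  let S' : Fin n → ℝ → Fin n → Set P.Msg := fun i t j => S (N t) i t j
  have h3 : ∀ k : ℕ, ∀ i, ∀ t < k * δ, ∀ j, S k i t j = S' i t j := by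
    intro k i t ht j
    calc S k i t j = S (k + N t) i t j := h2 _ _ _ _ ht _
      _ = S (N t + k) i t j := by rw [add_comm]
      _ = S' i t j := (h2 _ _ _ _ (hN' t) _).symm
  have h4 : ∀ i t j, S' i t j = P.respond input H byz D S' i t j := by
    intro i t j
    have ht : t < N t * δ + δ := by linarith [hN' t]
    rw [← P.respond_congr input H byz hD (h3 (N t)) i t ht j, ← hS]
    exact (h3 (N t + 1) i t (by push_cast; linarith) j).symm
  refine ⟨⟨H, S', fun i j _ _ => D i j⟩, rfl, fun _ _ _ _ => rfl, ?_, ?_⟩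
  · intro i hi t j
    refine (h4 i t j).trans ?_
    ext m
    simp [respond, hi]
  · intro i hi t j
    refine (h4 i t j).trans ?_
    ext m
    simp [respond, hi]

/-- To check the unforgeability of signatures in a run with delays bounded below, it is enough to
check the messages of the Byzantine parties; for the others it follows from `no_forge`. -/
theorem isExecution_of_byzantine_unforgeable {P : Protocol.{w} n In Out} {input : Fin n → In}
    {R : Run n P.Msg} {f : ℕ} {D : Fin n → Fin n → ℝ} {δ δ' : ℝ} (hδ : 0 < δ)
    (hD : ∀ i j, δ ≤ D i j) (hR : ∀ i j t m, R.delay i j t m = D i j)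
    (hf : R.honestᶜ.card ≤ f) (hD' : ∀ i ∈ R.honest, ∀ j ∈ R.honest, D i j ≤ δ')
    (hH : ∀ i ∈ R.honest, ∀ t j, R.sent i t j =
        {m | 0 ≤ t ∧ P.Active input R i t ∧ m ∈ P.send i (input i) t (R.history i t) j})
    (hbyz : ∀ i ∉ R.honest, ∀ t j m, m ∈ R.sent i t j → 0 ≤ t)
    (hsig : ∀ i ∉ R.honest, ∀ t j m, m ∈ R.sent i t j → ∀ k ∈ R.honest, ∀ s,
      (k, s) ∈ P.signatures m → ∃ t' ≤ t, P.Signs input R k t' s) :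
    P.IsExecution f δ' input R := by
  have h0 : ∀ i t j m, m ∈ R.sent i t j → 0 ≤ t := by
    intro i t j m hm
    by_cases hi : i ∈ R.honest
    · rw [hH i hi] at hm
      exact hm.1
    · exact hbyz i hi t j m hm
  refine ⟨hf, h0, hH, fun i t j m _ => ?_, fun i hi j hj t m _ => ?_, ?_⟩
  · rw [hR]; exact hδ.le.trans (hD i j)
  · rw [hR]; exact hD' i hi j hj
  · intro i t
    revert i
    refine real_step_induction hδ (p := fun t => ∀ i j m, m ∈ R.sent i t j → ∀ k ∈ R.honest, ∀ s,
      (k, s) ∈ P.signatures m → ∃ t' ≤ t, P.Signs input R k t' s) ?_ ?_ t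
    · intro t ht i j m hm
      linarith [h0 i t j m hm]
    · intro t ih i j m hm k hk s hs
      by_cases hi : i ∈ R.honest
      · have hm' := hm
        rw [hH i hi] at hm'
        obtain ⟨ht, hact, hm'⟩ := hm'
        rcases P.no_forge i _ t _ j m ht (fun e he => he.1) hm' k s hs with
          ⟨rfl, t', ht', htt, hsg⟩ | ⟨e, ⟨he1, r, he2, he3⟩, hes⟩
        · rw [R.history_upTo _ htt] at hsg
          exact ⟨t', htt, ht', hact.mono htt, hsg⟩
        · rw [hR] at he3
          have hr : r ≤ t - δ := by linarith [hD e.sender i]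
          obtain ⟨t', htr, hsg⟩ := ih r hr e.sender i e.msg he2 k hk s hes
          exact ⟨t', by linarith, hsg⟩
      · exact hsig i hi t j m hm k hk s hs

end Protocol

/-! ### The lower bound on the good-case latency -/

section LowerBound

variable {n : ℕ} {V : Type u}

open Classical in
/-- The delays in the executions of the lower bound: `Δ` between `A` and `C`, else `δ`. -/
noncomputable def splitDelay (A C : Finset (Fin n)) (δ Δ : ℝ) (i j : Fin n) : ℝ :=
  if (i ∈ A ∧ j ∈ C) ∨ (i ∈ C ∧ j ∈ A) then Δ else δ

theorem splitDelay_comm (A C : Finset (Fin n)) (δ Δ : ℝ) :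
    splitDelay A C δ Δ = splitDelay C A δ Δ := by
  ext i j
  simp only [splitDelay, or_comm]

theorem le_splitDelay (A C : Finset (Fin n)) {δ Δ : ℝ} (h : δ ≤ Δ) (i j : Fin n) :
    δ ≤ splitDelay A C δ Δ i j := by
  unfold splitDelay
  split_ifs <;> linarith

theorem splitDelay_le (A C : Finset (Fin n)) {δ Δ : ℝ} (h : δ ≤ Δ) (i j : Fin n) :
    splitDelay A C δ Δ i j ≤ Δ := by
  unfold splitDelay
  split_ifs <;> linarith

theorem splitDelay_of_notMem {A C : Finset (Fin n)} {δ Δ : ℝ} {i j : Fin n} (hi : i ∉ C)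
    (hj : j ∉ C) : splitDelay A C δ Δ i j = δ := by
  simp [splitDelay, hi, hj]

theorem splitDelay_of_mem {A C : Finset (Fin n)} {δ Δ : ℝ} {i j : Fin n} (hi : i ∈ C)
    (hj : j ∈ A) : splitDelay A C δ Δ i j = Δ := by
  simp [splitDelay, hi, hj]

/-- What a party without input sends as long as it has received nothing, up to time `δ`. -/
def blindSent (P : Protocol.{w} n (Option V) (Option V)) (δ : ℝ) (i : Fin n) (t : ℝ) (j : Fin n) :
    Set P.Msg :=
  {m | 0 ≤ t ∧ t < δ ∧ (∀ t', 0 ≤ t' → t' < t → ¬ P.halt i none t' ∅) ∧ m ∈ P.send i none t ∅ j}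

/-- A run in which the broadcaster has input `v`, all parties outside `C` follow the protocol, and
the parties of `C` send to those of `A` what they send before having received anything, and nothing
else. -/
structure IsOneSided (P : Protocol.{w} n (Option V) (Option V)) (L : Fin n) (A C : Finset (Fin n))
    (δ Δ : ℝ) (v : V) (R : Run n P.Msg) : Prop where
  honest : R.honest = Cᶜ
  delay : ∀ i j t m, R.delay i j t m = splitDelay A C δ Δ i j
  honest_sent : ∀ i ∉ C, ∀ t j, R.sent i t j = {m | 0 ≤ t ∧ P.Active (broadcastInput L v) R i t ∧
    m ∈ P.send i (broadcastInput L v i) t (R.history i t) j}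
  byz_sent : ∀ i ∈ C, ∀ t j, R.sent i t j = {m | j ∈ A ∧ m ∈ blindSent P δ i t j}

theorem exists_isOneSided (P : Protocol.{w} n (Option V) (Option V)) (L : Fin n)
    (A C : Finset (Fin n)) {δ Δ : ℝ} (hδ : 0 < δ) (hΔ : δ ≤ Δ) (v : V) :
    ∃ R, IsOneSided P L A C δ Δ v R := by
  obtain ⟨R, h1, h2, h3, h4⟩ := P.exists_run (broadcastInput L v) Cᶜ
    (fun i t j => {m | j ∈ A ∧ m ∈ blindSent P δ i t j}) (fun i t j m hm => hm.2.1) hδ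
    (le_splitDelay A C hΔ)
  exact ⟨R, h1, h2, fun i hi => h3 i (by simpa using hi), fun i hi => h4 i (by simpa using hi)⟩

theorem IsOneSided.isExecution {P : Protocol.{w} n (Option V) (Option V)} {L : Fin n}
    {A C : Finset (Fin n)} {δ Δ : ℝ} {v : V} {R : Run n P.Msg} (h : IsOneSided P L A C δ Δ v R)
    (hδ : 0 < δ) (hΔ : δ ≤ Δ) {f : ℕ} (hC : C.card ≤ f) :
    P.IsExecution f δ (broadcastInput L v) R := by
  have hmem : ∀ i, i ∈ R.honest ↔ i ∉ C := by simp [h.honest]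
  refine Protocol.isExecution_of_byzantine_unforgeable hδ (le_splitDelay A C hΔ) h.delay
    (by rwa [h.honest, compl_compl]) ?_ ?_ ?_ ?_
  · intro i hi j hj
    exact (splitDelay_of_notMem ((hmem i).1 hi) ((hmem j).1 hj)).le
  · intro i hi
    exact h.honest_sent i ((hmem i).1 hi)
  · intro i hi t j m hm
    rw [h.byz_sent i (by simpa [hmem] using hi)] at hm
    exact hm.2.1
  · intro i hi t j m hm k hk s hs
    have hiC : i ∈ C := by simpa [hmem] using hi
    rw [h.byz_sent i hiC] at hm
    obtain ⟨-, ht, -, -, hm⟩ := hm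
    -- a message sent before anything was received contains signatures of its sender only
    rcases P.no_forge i none t ∅ j m ht (fun e he => he.elim) hm k s hs with
      ⟨rfl, -⟩ | ⟨e, he, -⟩
    · exact absurd hiC ((hmem k).1 hk)
    · exact he.elim

/-- In a one-sided run, no message sent before time `Δ` by a party outside `C` contains a signature
of a party in `C`, since nothing sent by `C` has arrived by then. -/
theorem IsOneSided.signer_notMem {P : Protocol.{w} n (Option V) (Option V)} {L : Fin n}
    {A C : Finset (Fin n)} {δ Δ : ℝ} {v : V} {R : Run n P.Msg} (h : IsOneSided P L A C δ Δ v R)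
    (hδ : 0 < δ) (t : ℝ) : t < Δ → ∀ i ∉ C, ∀ j m, m ∈ R.sent i t j →
      ∀ k s, (k, s) ∈ P.signatures m → k ∉ C := by
  refine real_step_induction hδ (p := fun t => t < Δ → ∀ i ∉ C, ∀ j m, m ∈ R.sent i t j →
    ∀ k s, (k, s) ∈ P.signatures m → k ∉ C) ?_ ?_ t
  · intro t ht _ i hi j m hm
    rw [h.honest_sent i hi] at hm
    linarith [hm.1]
  · intro t ih htΔ i hi j m hm k s hs
    rw [h.honest_sent i hi] at hm
    obtain ⟨ht, hact, hm⟩ := hm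
    rcases P.no_forge i _ t _ j m ht (fun e he => he.1) hm k s hs with
      ⟨rfl, -⟩ | ⟨e, ⟨he1, r, he2, he3⟩, hes⟩
    · exact hi
    · rw [h.delay] at he3
      by_cases heC : e.sender ∈ C
      · rw [h.byz_sent _ heC] at he2
        rw [splitDelay_of_mem heC he2.1] at he3
        linarith [he2.2.1]
      · rw [splitDelay_of_notMem heC hi] at he3
        exact ih r (by linarith) (by linarith) e.sender heC i e.msg he2 k s hes

/-- A run in which the parties of `A` and of `C` follow the protocol, and the others behave towards
`A` as in the run `R₁` and towards `C` as in the run `R₂`, before time `Δ`. -/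
structure IsSplit (P : Protocol.{w} n (Option V) (Option V)) (L : Fin n) (A C : Finset (Fin n))
    (δ Δ : ℝ) (v : V) (R₁ R₂ R : Run n P.Msg) : Prop where
  honest : R.honest = A ∪ C
  delay : ∀ i j t m, R.delay i j t m = splitDelay A C δ Δ i j
  honest_sent : ∀ i ∈ A ∪ C, ∀ t j, R.sent i t j = {m | 0 ≤ t ∧
    P.Active (broadcastInput L v) R i t ∧ m ∈ P.send i (broadcastInput L v i) t (R.history i t) j}
  byz_sent : ∀ i ∉ A ∪ C, ∀ t j, R.sent i t j =
    {m | t < Δ ∧ ((j ∈ A ∧ m ∈ R₁.sent i t j) ∨ (j ∈ C ∧ m ∈ R₂.sent i t j))}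

theorem IsSplit.symm {P : Protocol.{w} n (Option V) (Option V)} {L : Fin n} {A C : Finset (Fin n)}
    {δ Δ : ℝ} {v : V} {R₁ R₂ R : Run n P.Msg} (h : IsSplit P L A C δ Δ v R₁ R₂ R) :
    IsSplit P L C A δ Δ v R₂ R₁ R where
  honest := by rw [h.honest, Finset.union_comm]
  delay := by rw [splitDelay_comm]; exact h.delay
  honest_sent := by rw [Finset.union_comm]; exact h.honest_sent
  byz_sent := by
    rw [Finset.union_comm]
    intro i hi t j
    rw [h.byz_sent i hi]
    simp only [or_comm]

variable {P : Protocol.{w} n (Option V) (Option V)} {L : Fin n} {A C : Finset (Fin n)}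
  {δ Δ : ℝ} {v v₁ v₂ : V} {R₁ R₂ R : Run n P.Msg}

theorem IsSplit.sent_nonneg (h : IsSplit P L A C δ Δ v R₁ R₂ R)
    (h₁ : IsOneSided P L A C δ Δ v₁ R₁) (h₂ : IsOneSided P L C A δ Δ v₂ R₂)
    {i j : Fin n} {t : ℝ} {m : P.Msg} (hm : m ∈ R.sent i t j) : 0 ≤ t := by
  by_cases hi : i ∈ A ∪ C
  · rw [h.honest_sent i hi] at hm
    exact hm.1
  · rw [h.byz_sent i hi] at hm
    rw [Finset.mem_union, not_or] at hi
    rcases hm with ⟨-, ⟨-, hm⟩ | ⟨-, hm⟩⟩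
    · rw [h₁.honest_sent i hi.2] at hm
      exact hm.1
    · rw [h₂.honest_sent i hi.1] at hm
      exact hm.1

/-- Nothing arrives before time `δ`. -/
theorem IsSplit.history_eq_empty (h : IsSplit P L A C δ Δ v R₁ R₂ R)
    (h₁ : IsOneSided P L A C δ Δ v₁ R₁) (h₂ : IsOneSided P L C A δ Δ v₂ R₂) (hΔ : δ ≤ Δ)
    (j : Fin n) {t : ℝ} (ht : t < δ) : R.history j t = ∅ := by
  rw [Set.eq_empty_iff_forall_notMem]
  rintro e ⟨he1, s, he2, he3⟩
  rw [h.delay] at he3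
  linarith [h.sent_nonneg h₁ h₂ he2, le_splitDelay A C hΔ e.sender j]

/-- Until time `Δ + δ`, the parties of `A` cannot tell the split run from the one-sided run `R₁`:
what they receive from `C` by then was sent before `C` had received anything. -/
theorem IsSplit.history_eq (h : IsSplit P L A C δ Δ v R₁ R₂ R)
    (h₁ : IsOneSided P L A C δ Δ v₁ R₁) (h₂ : IsOneSided P L C A δ Δ v₂ R₂)
    (hδ : 0 < δ) (hΔ : δ ≤ Δ) (hAC : Disjoint A C) (hA : L ∉ A) (hC : L ∉ C) (t : ℝ) :
    t < Δ + δ → ∀ j ∈ A, R₁.history j t = R.history j t := by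
  have hin : ∀ i ∈ A, broadcastInput L v₁ i = broadcastInput L v i := by
    intro i hi
    have : i ≠ L := fun hL => hA (hL ▸ hi)
    simp [broadcastInput, this]
  have hinC : ∀ i ∈ C, broadcastInput L v i = none := by
    intro i hi
    have : i ≠ L := fun hL => hC (hL ▸ hi)
    simp [broadcastInput, this]
  refine real_step_induction hδ (p := fun t => t < Δ + δ → ∀ j ∈ A,
    R₁.history j t = R.history j t) ?_ ?_ t
  · intro t ht _ j hj
    rw [h.history_eq_empty h₁ h₂ hΔ j (by linarith), Set.eq_empty_iff_forall_notMem]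
    rintro e ⟨he1, s, he2, he3⟩
    rw [h₁.delay] at he3
    have h0 : 0 ≤ s := by
      by_cases heC : e.sender ∈ C
      · rw [h₁.byz_sent _ heC] at he2
        exact he2.2.1
      · rw [h₁.honest_sent _ heC] at he2
        exact he2.1
    linarith [le_splitDelay A C hΔ e.sender j]
  · intro t ih ht j hj
    have hjC : j ∉ C := Finset.disjoint_left.1 hAC hj
    refine Run.history_congr h₁.delay h.delay fun i s hs => ?_
    by_cases hiC : i ∈ C
    · rw [splitDelay_of_mem hiC hj] at hs
      rw [h₁.byz_sent i hiC, h.honest_sent i (Finset.mem_union_right _ hiC), hinC i hiC,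
        h.history_eq_empty h₁ h₂ hΔ i (by linarith)]
      ext m
      constructor
      · rintro ⟨-, h0, hsδ, hact, hm⟩
        refine ⟨h0, fun t' ht0 hts => ?_, hm⟩
        rw [hinC i hiC, h.history_eq_empty h₁ h₂ hΔ i (by linarith)]
        exact hact t' ht0 hts
      · rintro ⟨h0, hact, hm⟩
        refine ⟨hj, h0, by linarith, fun t' ht0 hts => ?_, hm⟩
        have := hact t' ht0 hts
        rwa [hinC i hiC, h.history_eq_empty h₁ h₂ hΔ i (by linarith)] at this
    · rw [splitDelay_of_notMem hiC hjC] at hs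
      by_cases hiA : i ∈ A
      · have hh : ∀ r ≤ s, R₁.history i r = R.history i r := fun r hr =>
          ih r (by linarith) (by linarith) i hiA
        rw [h₁.honest_sent i hiC, h.honest_sent i (Finset.mem_union_left _ hiA), hin i hiA,
          hh s le_rfl]
        ext m
        refine and_congr_right fun _ => and_congr_left fun _ => ⟨fun ha => ?_, fun ha => ?_⟩
        · exact ha.congr (hin i hiA) fun r hr => hh r hr.le
        · exact ha.congr (hin i hiA).symm fun r hr => (hh r hr.le).symm
      · rw [h.byz_sent i (by simp [hiA, hiC])]
        ext m
        have : s < Δ := by linarith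
        simp [this, hj, hjC]

/-- The Byzantine parties of a split run can send to `A` what they send in the run `R₁`: it contains
no signature of `C`, and the signatures of `A` are made in the split run, too. -/
theorem IsSplit.signs (h : IsSplit P L A C δ Δ v R₁ R₂ R)
    (h₁ : IsOneSided P L A C δ Δ v₁ R₁) (h₂ : IsOneSided P L C A δ Δ v₂ R₂)
    (hδ : 0 < δ) (hΔ : δ ≤ Δ) (hAC : Disjoint A C) (hA : L ∉ A) (hC : L ∉ C)
    {i j : Fin n} (hi : i ∉ C) {t : ℝ} (ht : t < Δ) {m : P.Msg} (hm : m ∈ R₁.sent i t j)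
    {k : Fin n} (hk : k ∈ A ∪ C) {s : P.Stmt} (hs : (k, s) ∈ P.signatures m) :
    ∃ t' ≤ t, P.Signs (broadcastInput L v) R k t' s := by
  have hkC : k ∉ C := h₁.signer_notMem hδ t ht i hi j m hm k s hs
  have hkA : k ∈ A := (Finset.mem_union.1 hk).resolve_right hkC
  obtain ⟨t', htt, h0, hact, hsg⟩ := (h₁.isExecution hδ hΔ le_rfl).unforgeable i t j m hm k
    (by simpa [h₁.honest] using hkC) s hs
  have hin : broadcastInput L v₁ k = broadcastInput L v k := by
    have : k ≠ L := fun hL => hA (hL ▸ hkA)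
    simp [broadcastInput, this]
  have hh := fun r (hr : r ≤ t') =>
    h.history_eq h₁ h₂ hδ hΔ hAC hA hC r (by linarith) k hkA
  refine ⟨t', htt, h0, hact.congr hin fun r hr => hh r hr.le, ?_⟩
  rwa [← hin, ← hh t' le_rfl]

theorem IsSplit.isExecution (h : IsSplit P L A C δ Δ v R₁ R₂ R)
    (h₁ : IsOneSided P L A C δ Δ v₁ R₁) (h₂ : IsOneSided P L C A δ Δ v₂ R₂)
    (hδ : 0 < δ) (hΔ : δ ≤ Δ) (hAC : Disjoint A C) (hA : L ∉ A) (hC : L ∉ C) {f : ℕ}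
    (hf : (A ∪ C)ᶜ.card ≤ f) : P.IsExecution f Δ (broadcastInput L v) R := by
  refine Protocol.isExecution_of_byzantine_unforgeable hδ (le_splitDelay A C hΔ) h.delay
    (by rwa [h.honest]) (fun i _ j _ => splitDelay_le A C hΔ i j) ?_
    (fun i _ t j m hm => h.sent_nonneg h₁ h₂ hm) ?_
  · rw [h.honest]
    exact h.honest_sent
  · rw [h.honest]
    intro i hi t j m hm k hk s hs
    rw [h.byz_sent i hi] at hm
    rw [Finset.mem_union, not_or] at hi
    rcases hm with ⟨ht, ⟨-, hm⟩ | ⟨-, hm⟩⟩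
    · exact h.signs h₁ h₂ hδ hΔ hAC hA hC hi.2 ht hm hk hs
    · exact h.symm.signs h₂ h₁ hδ hΔ hAC.symm hC hA hi.1 ht hm (Finset.union_comm A C ▸ hk) hs

/-- If the good-case latency is less than `Δ + δ`, then in the split run the parties of `A` commit
the value `v₁` of the one-sided run `R₁`. -/
theorem IsSplit.exists_commits (h : IsSplit P L A C δ Δ v R₁ R₂ R)
    (h₁ : IsOneSided P L A C δ Δ v₁ R₁) (h₂ : IsOneSided P L C A δ Δ v₂ R₂)
    (hδ : 0 < δ) (hΔ : δ ≤ Δ) (hAC : Disjoint A C) (hA : L ∉ A) (hC : L ∉ C) {f : ℕ}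
    (hf : C.card ≤ f) (hP : P.SolvesBB L f Δ) {T : ℝ} (hT : P.HasGoodCaseLatency L f δ T)
    (hlt : T < Δ + δ) {i : Fin n} (hi : i ∈ A) :
    ∃ t, P.Commits (broadcastInput L v) R i t (some v₁) := by
  have hex := h₁.isExecution hδ hΔ hf
  have hL : L ∈ R₁.honest := by simpa [h₁.honest] using hC
  have hih : i ∈ R₁.honest := by
    simpa [h₁.honest] using Finset.disjoint_left.1 hAC hi
  obtain ⟨t, x, htT, hx⟩ := hT v₁ R₁ hex hL i hih
  obtain ⟨hagr, hval, -⟩ := hP v₁ δ R₁ hδ.le hΔ hex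
  obtain ⟨⟨t', ht'⟩, -⟩ := hval hL i hih
  obtain rfl := hagr i hih i hih t t' x _ hx ht'
  have hin : broadcastInput L v₁ i = broadcastInput L v i := by
    have : i ≠ L := fun hL => hA (hL ▸ hi)
    simp [broadcastInput, this]
  have hh := fun r (hr : r ≤ t) =>
    h.history_eq h₁ h₂ hδ hΔ hAC hA hC r (by linarith) i hi
  obtain ⟨h0, hact, hc⟩ := hx
  refine ⟨t, h0, hact.congr hin fun r hr => hh r hr.le, ?_⟩
  rwa [← hin, ← hh t le_rfl]

/-- The indistinguishability argument with `|A| = |C| = f` and the broadcaster in neither: in the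
split run the parties of `A` and those of `C` would commit different values. -/
theorem le_of_hasGoodCaseLatency [Nontrivial V] {f : ℕ} (hf : n < 3 * f) (hf' : 2 * f < n)
    (hP : P.SolvesBB L f Δ) (hδ : 0 < δ) (hΔ : δ ≤ Δ) {T : ℝ}
    (hT : P.HasGoodCaseLatency L f δ T) : Δ + δ ≤ T := by
  by_contra! hlt
  obtain ⟨A, hAs, hAc⟩ := Finset.exists_subset_card_eq (s := Finset.univ.erase L) (n := f)
    (by rw [Finset.card_erase_of_mem (Finset.mem_univ L), Finset.card_univ, Fintype.card_fin]; omega)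
  obtain ⟨C, hCs, hCc⟩ := Finset.exists_subset_card_eq (s := Finset.univ.erase L \ A) (n := f) (by
    rw [Finset.card_sdiff_of_subset hAs, Finset.card_erase_of_mem (Finset.mem_univ L),
      Finset.card_univ, Fintype.card_fin]
    omega)
  have hAC : Disjoint A C := Finset.disjoint_left.2 fun i hi hi' =>
    (Finset.mem_sdiff.1 (hCs hi')).2 hi
  have hA : L ∉ A := fun hL => by simpa using hAs hL
  have hC : L ∉ C := fun hL => by simpa using hCs hL
  have hcard : (A ∪ C)ᶜ.card ≤ f := by
    rw [Finset.card_compl, Finset.card_union_of_disjoint hAC, Fintype.card_fin]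
    omega
  obtain ⟨i, hi⟩ := Finset.card_pos.1 (by omega : 0 < A.card)
  obtain ⟨j, hj⟩ := Finset.card_pos.1 (by omega : 0 < C.card)
  obtain ⟨v₁, v₂, hv⟩ := exists_pair_ne V
  obtain ⟨R₁, h₁⟩ := exists_isOneSided P L A C hδ hΔ v₁
  obtain ⟨R₂, h₂⟩ := exists_isOneSided P L C A hδ hΔ v₂
  obtain ⟨R, hR1, hR2, hR3, hR4⟩ := P.exists_run (broadcastInput L v₁) (A ∪ C)
    (fun i t j => {m | 0 ≤ t ∧ t < Δ ∧ ((j ∈ A ∧ m ∈ R₁.sent i t j) ∨ (j ∈ C ∧ m ∈ R₂.sent i t j))})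
    (fun i t j m hm => hm.1) hδ (le_splitDelay A C hΔ)
  have h : IsSplit P L A C δ Δ v₁ R₁ R₂ R := by
    refine ⟨hR1, hR2, hR3, fun i hi t j => ?_⟩
    rw [hR4 i hi]
    ext m
    refine ⟨fun hm => hm.2, fun hm => ⟨?_, hm⟩⟩
    rcases hm with ⟨-, ⟨-, hm⟩ | ⟨-, hm⟩⟩
    · exact (h₁.isExecution hδ hΔ le_rfl).sent_nonneg i t j m hm
    · exact (h₂.isExecution hδ hΔ le_rfl).sent_nonneg i t j m hm
  obtain ⟨t, ht⟩ := h.exists_commits h₁ h₂ hδ hΔ hAC hA hC hCc.le hP hT hlt hi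
  obtain ⟨t', ht'⟩ := h.symm.exists_commits h₂ h₁ hδ hΔ hAC.symm hC hA hAc.le hP hT hlt hj
  have hagr := (hP v₁ Δ R (hδ.le.trans hΔ) le_rfl
    (h.isExecution h₁ h₂ hδ hΔ hAC hA hC hcard)).1
  have := hagr i (by simp [h.honest, hi]) j (by simp [h.honest, hj]) t t' _ _ ht ht'
  exact hv (Option.some.inj this)

end LowerBound

/-! ### Reduction to the agreement instance -/

section Agreement

variable {n f : ℕ} {V : Type u} {L : Fin n} {Δ : ℝ} {hΔ : 0 < Δ}
  {A : Protocol.{w} n (Option V) (Option V)} {input : Fin n → Option V}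
  {R : Run n (BBMsg n V A.Msg)} {δ : ℝ}

/-- The input of a party to the agreement instance: its lock at time `4Δ`. -/
noncomputable def lockInput (L : Fin n) (f : ℕ) (Δ : ℝ) {M : Type w} (R : Run n (BBMsg n V M))
    (i : Fin n) : Option V :=
  lock L f Δ (R.history i (4 * Δ))

open Classical in
/-- The run of the agreement instance inside a run of the broadcast protocol, on the clock that
starts at time `4Δ`. Byzantine parties may have sent agreement messages before the instance started,
so their messages are taken to be sent at the time of receipt, with delay `0`. -/
noncomputable def baRun (Δ : ℝ) {M : Type w} (R : Run n (BBMsg n V M)) : Run n M where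
  honest := R.honest
  sent i t j := {m | 0 ≤ t ∧ if i ∈ R.honest then BBMsg.ba m ∈ R.sent i (t + 4 * Δ) j else
    ∃ s, BBMsg.ba m ∈ R.sent i s j ∧ t + 4 * Δ = s + R.delay i j s (.ba m)}
  delay i j t m := if i ∈ R.honest then R.delay i j (t + 4 * Δ) (.ba m) else 0

/-- The sending rules with `R` as a run over `BBMsg`, which is the message type of `bbProtocol` only
after unfolding; in this form they can be used for rewriting. -/
theorem bb_mem_sent_iff (hR : (bbProtocol L f Δ hΔ A).IsExecution f δ input R) {i : Fin n}
    (hi : i ∈ R.honest) {t : ℝ} {j : Fin n} {m : BBMsg n V A.Msg} :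
    m ∈ R.sent i t j ↔ 0 ≤ t ∧ (bbProtocol L f Δ hΔ A).Active input R i t ∧
      ((i = L ∧ t = 0 ∧ ∃ v, input i = some v ∧ m = .propose ⟨L, v⟩) ∨
      (t ≤ Δ ∧ ∃ v, VotesFor L (R.history i t) t v ∧ m = .vote ⟨i, t, ⟨L, v⟩⟩) ∨
      (∃ v, CommitRule L f Δ (R.history i t) (t - Δ) v ∧
        ∃ a, ReceivesVote L (R.history i t) v (t - Δ) t a ∧ m = .vote a) ∨
      (4 * Δ ≤ t ∧ ∃ m', m = .ba m' ∧
        m' ∈ A.send i (lock L f Δ ((R.history i t).upTo (4 * Δ))) (t - 4 * Δ)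
          (baHistory Δ (R.history i t)) j)) :=
  Set.ext_iff.1 (hR.honest_sent i hi t j) m

theorem ba_mem_sent_iff (hR : (bbProtocol L f Δ hΔ A).IsExecution f δ input R) {i : Fin n}
    (hi : i ∈ R.honest) {t : ℝ} {j : Fin n} {m : A.Msg} :
    BBMsg.ba m ∈ R.sent i t j ↔ 4 * Δ ≤ t ∧ (bbProtocol L f Δ hΔ A).Active input R i t ∧
      m ∈ A.send i (lockInput L f Δ R i) (t - 4 * Δ) (baHistory Δ (R.history i t)) j := by
  rw [bb_mem_sent_iff hR hi]
  constructor
  · rintro ⟨-, hact, ⟨-, -, _, -, h⟩ | ⟨-, _, -, h⟩ | ⟨_, -, _, -, h⟩ | ⟨h4, m', h, hm⟩⟩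
    · cases h
    · cases h
    · cases h
    · cases h
      rw [R.history_upTo i h4] at hm
      exact ⟨h4, hact, hm⟩
  · rintro ⟨h4, hact, hm⟩
    refine ⟨by linarith, hact, Or.inr (Or.inr (Or.inr ⟨h4, m, rfl, ?_⟩))⟩
    rwa [R.history_upTo i h4]

theorem bb_unforgeable (hR : (bbProtocol L f Δ hΔ A).IsExecution f δ input R) {i j k : Fin n}
    {t : ℝ} {m : BBMsg n V A.Msg} (hm : m ∈ R.sent i t j) (hk : k ∈ R.honest)
    {s : BBStmt n V A.Stmt} (hs : (k, s) ∈ bbSignatures A.signatures m) :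
    ∃ t' ≤ t, (bbProtocol L f Δ hΔ A).Active input R k t' ∧
      ((k = L ∧ t' = 0 ∧ ∃ v, input k = some v ∧ s = .propose v) ∨
      (t' ≤ Δ ∧ ∃ v, VotesFor L (R.history k t') t' v ∧ s = .vote t' ⟨L, v⟩) ∨
      (4 * Δ ≤ t' ∧ ∃ s', s = .ba s' ∧
        s' ∈ A.sign k (lock L f Δ ((R.history k t').upTo (4 * Δ))) (t' - 4 * Δ)
          (baHistory Δ (R.history k t')))) := by
  obtain ⟨t', ht, -, hact, hsg⟩ := hR.unforgeable i t j m hm k hk s hs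
  exact ⟨t', ht, hact, hsg⟩

/-- No party terminates before the agreement instance starts. -/
theorem bb_active (i : Fin n) {t : ℝ} (ht : t ≤ 4 * Δ) :
    (bbProtocol L f Δ hΔ A).Active input R i t :=
  fun _ _ h2 h3 => absurd h3.1 (by linarith)

/-- A party's view in `baRun` is the one that the broadcast protocol hands to the instance. -/
theorem baRun_history (hR : (bbProtocol L f Δ hΔ A).IsExecution f δ input R) (j : Fin n) (t : ℝ) :
    (baRun Δ R).history j t = baHistory Δ (R.history j (t + 4 * Δ)) := by
  ext e
  constructor
  · rintro ⟨h1, s, ⟨h2, h3⟩, h4⟩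
    by_cases he : e.sender ∈ R.honest
    · simp only [baRun, he, if_true] at h3 h4
      have := hR.delay_nonneg _ _ _ _ h3
      exact ⟨by rw [h4]; exact add_nonneg h2 this, by simpa using h1, s + 4 * Δ, h3,
        by simp only; linarith⟩
    · simp only [baRun, he, if_false] at h3 h4
      obtain ⟨r, h5, h6⟩ := h3
      exact ⟨by linarith, by simpa using h1, r, h5, by simp only; linarith⟩
  · rintro ⟨h1, h2, s, h3, h4⟩
    simp only at h2 h3 h4
    refine ⟨by linarith, ?_⟩
    by_cases he : e.sender ∈ R.honest
    · have h6 := ((ba_mem_sent_iff hR he).1 h3).1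
      refine ⟨s - 4 * Δ, ⟨by linarith, ?_⟩, ?_⟩
      · simpa [he] using h3
      · simp only [baRun, he, if_true, sub_add_cancel]
        linarith
    · refine ⟨e.time, ⟨h1, ?_⟩, ?_⟩
      · simp only [he, if_false]
        exact ⟨s, h3, h4⟩
      · simp [baRun, he]

theorem halt_iff (hR : (bbProtocol L f Δ hΔ A).IsExecution f δ input R) (i : Fin n) {t : ℝ}
    (ht : 0 ≤ t) :
    (bbProtocol L f Δ hΔ A).halt i (input i) (t + 4 * Δ) (R.history i (t + 4 * Δ)) ↔
      A.halt i (lockInput L f Δ R i) t ((baRun Δ R).history i t) := by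
  have key : (bbProtocol L f Δ hΔ A).halt i (input i) (t + 4 * Δ) (R.history i (t + 4 * Δ)) ↔
      4 * Δ ≤ t + 4 * Δ ∧ A.halt i (lock L f Δ ((R.history i (t + 4 * Δ)).upTo (4 * Δ)))
        (t + 4 * Δ - 4 * Δ) (baHistory Δ (R.history i (t + 4 * Δ))) := Iff.rfl
  rw [baRun_history hR, key, R.history_upTo i (by linarith), add_sub_cancel_right]
  exact ⟨fun h => h.2, fun h => ⟨by linarith, h⟩⟩

theorem active_iff (hR : (bbProtocol L f Δ hΔ A).IsExecution f δ input R) (i : Fin n) (t : ℝ) :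
    (bbProtocol L f Δ hΔ A).Active input R i (t + 4 * Δ) ↔
      A.Active (lockInput L f Δ R) (baRun Δ R) i t := by
  constructor
  · intro h t' h0 ht hh
    exact h (t' + 4 * Δ) (by linarith) (by linarith) ((halt_iff hR i h0).2 hh)
  · intro h t' h0 ht hh
    have h4 : 4 * Δ ≤ t' := hh.1
    refine h (t' - 4 * Δ) (by linarith) (by linarith) ((halt_iff hR i (by linarith)).1 ?_)
    rwa [sub_add_cancel]

/-- Hence the properties of a protocol that solves Byzantine agreement apply to `baRun`. -/
theorem baRun_isExecution (hR : (bbProtocol L f Δ hΔ A).IsExecution f δ input R) :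
    A.IsExecution f δ (lockInput L f Δ R) (baRun Δ R) where
  faulty_le := hR.faulty_le
  sent_nonneg i t j m hm := hm.1
  honest_sent i hi t j := by
    replace hi : i ∈ R.honest := hi
    ext m
    refine and_congr_right fun h0 => ?_
    rw [if_pos hi, ba_mem_sent_iff hR hi, active_iff hR, add_sub_cancel_right, ← baRun_history hR]
    exact ⟨fun h => h.2, fun h => ⟨by linarith, h⟩⟩
  delay_nonneg i t j m hm := by
    by_cases hi : i ∈ R.honest
    · obtain ⟨-, hm⟩ := hm
      simp only [hi, if_true] at hm
      simpa [baRun, hi] using hR.delay_nonneg _ _ _ _ hm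
    · simp [baRun, hi]
  delay_le i hi j hj t m hm := by
    replace hi : i ∈ R.honest := hi
    obtain ⟨-, hm⟩ := hm
    simp only [hi, if_true] at hm
    simpa [baRun, hi] using hR.delay_le i hi j hj _ _ hm
  unforgeable i t j m hm k hk s hs := by
    obtain ⟨r, hr, hm⟩ : ∃ r ≤ t + 4 * Δ, BBMsg.ba m ∈ R.sent i r j := by
      obtain ⟨-, hm⟩ := hm
      by_cases hi : i ∈ R.honest
      · simp only [hi, if_true] at hm
        exact ⟨_, le_rfl, hm⟩
      · simp only [hi, if_false] at hm
        obtain ⟨r, hm, hr⟩ := hm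
        exact ⟨r, by linarith [hR.delay_nonneg _ _ _ _ hm], hm⟩
    obtain ⟨t', ht', hact, ⟨-, -, _, -, h⟩ | ⟨-, _, -, h⟩ | ⟨h4, s', h, hsg⟩⟩ :=
      bb_unforgeable hR hm hk (s := .ba s) ⟨s, hs, rfl⟩
    · cases h
    · cases h
    cases h
    rw [R.history_upTo k h4] at hsg
    refine ⟨t' - 4 * Δ, by linarith, by linarith, ?_, ?_⟩
    · rw [← active_iff hR, sub_add_cancel]
      exact hact
    · rwa [baRun_history hR, sub_add_cancel]

end Agreement

/-! ### Votes, commits and locks -/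

section Broadcast

variable {n f : ℕ} {V : Type u} {L : Fin n} {Δ : ℝ} {hΔ : 0 < Δ}
  {A : Protocol.{w} n (Option V) (Option V)} {input : Fin n → Option V}
  {R : Run n (BBMsg n V A.Msg)} {δ : ℝ}

theorem ReceivesVotes.exists_upTo {M : Type w} {h : History n (BBMsg n V M)} {v : V} {t s : ℝ}
    (hv : ReceivesVotes L f h v t s) : ∃ e ∈ h.upTo s, ContainsValue L v e.msg := by
  obtain ⟨Q, hQ, hv⟩ := hv
  obtain ⟨k, hk⟩ := Finset.card_pos.1 (by omega : 0 < Q.card)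
  obtain ⟨a, -, ha, -, -, e, he, hea⟩ := hv k hk
  exact ⟨e, he, by rw [hea]; exact ha⟩

theorem mem_history_of_sent {M : Type w} {R : Run n M} {i j : Fin n} {s t : ℝ} {m : M}
    (hm : m ∈ R.sent i s j) (ht : s + R.delay i j s m ≤ t) :
    (⟨s + R.delay i j s m, i, m⟩ : Delivery n M) ∈ R.history j t :=
  ⟨ht, s, hm, rfl⟩

/-- The vote that an honest party casts at time `d` reaches every honest party by time `d + δ`. -/
theorem vote_received (hR : (bbProtocol L f Δ hΔ A).IsExecution f δ input R) {k : Fin n}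
    (hk : k ∈ R.honest) {d : ℝ} (h0 : 0 ≤ d) (hd : d ≤ Δ) {v : V}
    (hv : VotesFor L (R.history k d) d v) {i : Fin n} (hi : i ∈ R.honest) :
    ∃ e ∈ R.history i (d + δ), e.msg = .vote ⟨k, d, ⟨L, v⟩⟩ := by
  have hm : (BBMsg.vote ⟨k, d, ⟨L, v⟩⟩ : BBMsg n V A.Msg) ∈ R.sent k d i := by
    rw [bb_mem_sent_iff hR hk]
    exact ⟨h0, bb_active k (by linarith), Or.inr (Or.inl ⟨hd, v, hv, rfl⟩)⟩
  exact ⟨_, mem_history_of_sent hm (by linarith [hR.delay_le k hk i hi _ _ hm]), rfl⟩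

/-- Of the signers of `f + 1` votes one is honest, and it has cast its vote at the time stamped. -/
theorem exists_honest_vote (hR : (bbProtocol L f Δ hΔ A).IsExecution f δ input R) {i : Fin n}
    {r t s : ℝ} {v : V} (hv : ReceivesVotes L f (R.history i r) v t s) :
    ∃ k ∈ R.honest, ∃ d, 0 ≤ d ∧ d ≤ t ∧ d ≤ Δ ∧ VotesFor L (R.history k d) d v := by
  obtain ⟨Q, hQ, hv⟩ := hv
  obtain ⟨k, hkQ, hk⟩ : ∃ k ∈ Q, k ∈ R.honest := by
    by_contra! hcon
    have : Q ⊆ R.honestᶜ := fun k hk => Finset.mem_compl.2 (hcon k hk)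
    have := Finset.card_le_card this
    have := hR.faulty_le
    omega
  obtain ⟨a, rfl, hav, ha0, hat, e, ⟨⟨-, q, hm, -⟩, -⟩, hea⟩ := hv k hkQ
  rw [hea] at hm
  obtain ⟨t', -, -, ⟨-, -, _, -, h⟩ | ⟨htΔ, w, hw, h⟩ | ⟨-, _, h, -⟩⟩ :=
    bb_unforgeable hR hm hk (s := .vote a.time a.proposal) (Or.inl rfl)
  · cases h
  · simp only [BBStmt.vote.injEq, hav, Proposal.mk.injEq, true_and] at h
    obtain ⟨h1, rfl⟩ := h
    rw [h1] at ha0 hat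
    exact ⟨a.signer, hk, t', ha0, hat, htΔ, hw⟩
  · cases h

/-- If an honest party sees `f + 1` votes for `v'` with time stamps up to `t`, an honest voter's
vote for `v'` has reached every honest party by time `t + Δ`. So an honest party that applies the
commit rule for `v` at that time knows of no other value. -/
theorem CommitRule.eq_of_receivesVotes (hR : (bbProtocol L f Δ hΔ A).IsExecution f δ input R)
    (hδ : δ ≤ Δ) {i j : Fin n} (hi : i ∈ R.honest) {v v' : V} {t t' r r' s : ℝ}
    (hr : t + Δ ≤ r) (hc : CommitRule L f Δ (R.history i r) t v)
    (hv : ReceivesVotes L f (R.history j r') v' t' s) (ht : t' ≤ t) : v' = v := by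
  by_contra hne
  obtain ⟨k, hk, d, h0, hdt, hdΔ, hvote⟩ := exists_honest_vote hR hv
  obtain ⟨e, ⟨he, he'⟩, hem⟩ := vote_received hR hk h0 hdΔ hvote hi
  refine hc.2.1 ⟨v', v, hne, ⟨e, ?_, by rw [hem]; exact rfl⟩, hc.2.2.exists_upTo⟩
  exact ⟨⟨by linarith, he'⟩, by linarith⟩

theorem CommitRule.unique (hR : (bbProtocol L f Δ hΔ A).IsExecution f δ input R)
    (hδ : δ ≤ Δ) {i j : Fin n} (hi : i ∈ R.honest) (hj : j ∈ R.honest) {v v' : V} {t t' r r' : ℝ}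
    (hr : t + Δ ≤ r) (hr' : t' + Δ ≤ r') (hc : CommitRule L f Δ (R.history i r) t v)
    (hc' : CommitRule L f Δ (R.history j r') t' v') : v = v' := by
  rcases le_total t t' with h | h
  · exact hc'.eq_of_receivesVotes hR hδ hj hr' hc.2.2 h
  · exact (hc.eq_of_receivesVotes hR hδ hi hr hc'.2.2 h).symm

/-- When an honest party applies the commit rule for `v`, every honest party is locked on `v` when
the agreement starts: the forwarded votes give `v` a rank `t`, and no other value can have a rank
that low. -/
theorem CommitRule.lockInput_eq (hR : (bbProtocol L f Δ hΔ A).IsExecution f δ input R)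
    (hδ : δ ≤ Δ) {i j : Fin n} (hi : i ∈ R.honest) (hj : j ∈ R.honest) {v : V} {t : ℝ}
    (hc : CommitRule L f Δ (R.history i (t + Δ)) t v) : lockInput L f Δ R j = some v := by
  obtain ⟨⟨ht0, htΔ⟩, -, Q, hQ, hvotes⟩ := id hc
  have hlock : LockRule L f Δ (R.history j (4 * Δ)) v t (2 * Δ + t) := by
    refine ⟨⟨ht0, htΔ⟩, le_rfl, Q, hQ, fun k hk => ?_⟩
    obtain ⟨a, hak, ha⟩ := hvotes k hk
    have hm : (BBMsg.vote a : BBMsg n V A.Msg) ∈ R.sent i (t + Δ) j := by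
      rw [bb_mem_sent_iff hR hi]
      refine ⟨by linarith, bb_active i (by linarith), Or.inr (Or.inr (Or.inl ⟨v, ?_, a, ?_, rfl⟩))⟩
      · rwa [add_sub_cancel_right]
      · rwa [add_sub_cancel_right]
    have hd := hR.delay_le i hi j hj _ _ hm
    exact ⟨a, hak, ha.1, ha.2.1, ha.2.2.1, _,
      ⟨mem_history_of_sent hm (by linarith), by simp only; linarith⟩, rfl⟩
  have hother : ∀ v' t' s', v' ≠ v → LockRule L f Δ (R.history j (4 * Δ)) v' t' s' → t < t' := by
    intro v' t' s' hne h'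
    by_contra! hle
    exact hne (hc.eq_of_receivesVotes hR hδ hi le_rfl h'.2.2 hle)
  have hex : ∃ v, LocksOn L f Δ (R.history j (4 * Δ)) v :=
    ⟨v, t, _, hlock, fun v' t' s' hne h' => Or.inl (hother v' t' s' hne h')⟩
  have huniq : ∀ v', LocksOn L f Δ (R.history j (4 * Δ)) v' → v' = v := by
    rintro v' ⟨t', s', h', hmin⟩
    by_contra hne
    have h1 := hother v' t' s' hne h'
    rcases hmin v t _ (Ne.symm hne) hlock with h2 | ⟨h2, -⟩ <;> linarith
  rw [lockInput, lock, dif_pos hex, huniq _ hex.choose_spec]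

/-- The commit rule with parameter `t` looks at the history up to time `t + Δ` only. -/
theorem CommitRule.congr_history {M : Type w} {R : Run n (BBMsg n V M)} {i : Fin n} {r r' t : ℝ}
    {v : V} (hr : t + Δ ≤ r) (hr' : t + Δ ≤ r')
    (hc : CommitRule L f Δ (R.history i r) t v) : CommitRule L f Δ (R.history i r') t v := by
  have h1 : (R.history i r).upTo (t + Δ) = (R.history i r').upTo (t + Δ) := by
    rw [R.history_upTo i hr, R.history_upTo i hr']
  unfold CommitRule Equivocation ReceivesVotes ReceivesVote at hc ⊢
  rwa [h1] at hc

theorem bb_commits_iff {i : Fin n} {t : ℝ} {y : Option V} :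
    (bbProtocol L f Δ hΔ A).Commits input R i t y ↔
      0 ≤ t ∧ (bbProtocol L f Δ hΔ A).Active input R i t ∧
      ((∃ v, CommitRule L f Δ (R.history i t) (t - Δ) v ∧ y = some v) ∨
      (4 * Δ ≤ t ∧ (¬ ∃ t' v, CommitRule L f Δ (R.history i t) t' v) ∧
        y ∈ A.commit i (lock L f Δ ((R.history i t).upTo (4 * Δ))) (t - 4 * Δ)
          (baHistory Δ (R.history i t)))) :=
  Iff.rfl

/-- A commit in the broadcast is a direct one, or one of the agreement instance by a party that has
not committed directly. -/
theorem bb_commits_cases (hR : (bbProtocol L f Δ hΔ A).IsExecution f δ input R) {i : Fin n} {t : ℝ}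
    {y : Option V} (h : (bbProtocol L f Δ hΔ A).Commits input R i t y) :
    (∃ t' v, y = some v ∧ CommitRule L f Δ (R.history i (t' + Δ)) t' v) ∨
      A.Commits (lockInput L f Δ R) (baRun Δ R) i (t - 4 * Δ) y := by
  obtain ⟨h0, hact, ⟨v, hv, rfl⟩ | ⟨h4, -, hy⟩⟩ := bb_commits_iff.1 h
  · exact Or.inl ⟨t - Δ, v, rfl, by rwa [sub_add_cancel]⟩
  · refine Or.inr ⟨by linarith, ?_, ?_⟩
    · rwa [← active_iff hR, sub_add_cancel]
    · rw [R.history_upTo i h4] at hy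
      rwa [baRun_history hR, sub_add_cancel]

theorem CommitRule.commits {i : Fin n} {t : ℝ} {v : V}
    (hc : CommitRule L f Δ (R.history i (t + Δ)) t v) :
    (bbProtocol L f Δ hΔ A).Commits input R i (t + Δ) (some v) := by
  obtain ⟨⟨h0, h1⟩, -⟩ := id hc
  refine ⟨by linarith, bb_active i (by linarith), Or.inl ⟨v, ?_, rfl⟩⟩
  rwa [add_sub_cancel_right]

/-- Two direct commits agree by `CommitRule.unique`, and two commits of the agreement instance by its
own agreement property. -/
theorem bb_agreement (hR : (bbProtocol L f Δ hΔ A).IsExecution f δ input R) (hA : A.SolvesBA f Δ)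
    (h0 : 0 ≤ δ) (hδ : δ ≤ Δ) {i j : Fin n} (hi : i ∈ R.honest) (hj : j ∈ R.honest) {t t' : ℝ}
    {x x' : Option V} (hx : (bbProtocol L f Δ hΔ A).Commits input R i t x)
    (hx' : (bbProtocol L f Δ hΔ A).Commits input R j t' x') : x = x' := by
  obtain ⟨hagr, hval, -⟩ := hA _ δ _ h0 hδ (baRun_isExecution hR)
  -- if an honest party commits `v` directly, the agreement is on `v` by its validity
  have mixed : ∀ {i j : Fin n} {s s' : ℝ} {v : V} {y : Option V}, i ∈ R.honest → j ∈ R.honest →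
      CommitRule L f Δ (R.history i (s + Δ)) s v →
      A.Commits (lockInput L f Δ R) (baRun Δ R) j s' y → some v = y := by
    intro i j s s' v y hi hj hc hy
    obtain ⟨r, hr⟩ := hval (some v) (fun k hk => hc.lockInput_eq hR hδ hi hk) j hj
    exact hagr j hj j hj _ _ _ _ hr hy
  rcases bb_commits_cases hR hx with ⟨s, v, rfl, hc⟩ | hb <;>
    rcases bb_commits_cases hR hx' with ⟨s', v', rfl, hc'⟩ | hb'
  · rw [hc.unique hR hδ hi hj le_rfl le_rfl hc']
  · exact mixed hi hj hc hb'
  · exact (mixed hj hi hc' hb).symm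
  · exact hagr i hi j hj _ _ _ _ hb hb'

theorem bb_termination (hR : (bbProtocol L f Δ hΔ A).IsExecution f δ input R)
    (hA : A.SolvesBA f Δ) (h0 : 0 ≤ δ) (hδ : δ ≤ Δ) {i : Fin n} (hi : i ∈ R.honest) :
    (∃ t x, (bbProtocol L f Δ hΔ A).Commits input R i t x) ∧
      ∃ t, (bbProtocol L f Δ hΔ A).Terminates input R i t := by
  obtain ⟨⟨t, x, ht, hact, hx⟩, s, hs, hact', hh⟩ :=
    (hA _ δ _ h0 hδ (baRun_isExecution hR)).2.2 i hi
  refine ⟨?_, s + 4 * Δ, by linarith, (active_iff hR i s).2 hact', (halt_iff hR i hs).2 hh⟩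
  by_cases hc : ∃ t' v, CommitRule L f Δ (R.history i (t + 4 * Δ)) t' v
  · obtain ⟨t', v, hc⟩ := hc
    have := hc.1.2
    exact ⟨_, _, (hc.congr_history (by linarith) le_rfl).commits⟩
  · refine ⟨t + 4 * Δ, x, bb_commits_iff.2
      ⟨by linarith, (active_iff hR i t).2 hact, Or.inr ⟨by linarith, hc, ?_⟩⟩⟩
    rw [R.history_upTo i (by linarith), add_sub_cancel_right, ← baRun_history hR]
    exact hx

/-! ### The good case -/

/-- An honest broadcaster signs no value but its input. -/
theorem value_eq_of_containsValue {v : V}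
    (hR : (bbProtocol L f Δ hΔ A).IsExecution f δ (broadcastInput L v) R) (hL : L ∈ R.honest)
    {i j : Fin n} {t : ℝ} {m : BBMsg n V A.Msg} (hm : m ∈ R.sent i t j) {v' : V}
    (hv : ContainsValue L v' m) : v' = v := by
  have hs : (L, BBStmt.propose v') ∈ bbSignatures A.signatures m := by
    cases m with
    | propose p =>
      obtain rfl : p = ⟨L, v'⟩ := hv
      exact rfl
    | vote a =>
      have ha : a.proposal = ⟨L, v'⟩ := hv
      refine Or.inr ?_
      rw [ha]
      exact rfl
    | ba m => exact hv.elim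
  obtain ⟨t', -, -, ⟨-, -, w, hw, h⟩ | ⟨-, w, -, h⟩ | ⟨-, _, h, -⟩⟩ :=
    bb_unforgeable hR hm hL hs
  · simp only [broadcastInput, if_true, Option.some.injEq] at hw
    cases h
    exact hw.symm
  · cases h
  · cases h

/-- If the broadcaster is honest, every honest party votes for its input within time `δ`. -/
theorem exists_votesFor {v : V}
    (hR : (bbProtocol L f Δ hΔ A).IsExecution f δ (broadcastInput L v) R) (hL : L ∈ R.honest)
    {k : Fin n} (hk : k ∈ R.honest) :
    ∃ d, 0 ≤ d ∧ d ≤ δ ∧ VotesFor L (R.history k d) d v := by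
  have hm : (BBMsg.propose ⟨L, v⟩ : BBMsg n V A.Msg) ∈ R.sent L 0 k := by
    rw [bb_mem_sent_iff hR hL]
    exact ⟨le_rfl, bb_active L (by linarith), Or.inl ⟨rfl, rfl, v, by simp [broadcastInput], rfl⟩⟩
  have hfirst : FirstProposal L (R.history k (0 + R.delay L k 0 (.propose ⟨L, v⟩)))
      (0 + R.delay L k 0 (.propose ⟨L, v⟩)) v := by
    refine ⟨mem_history_of_sent hm le_rfl, ?_⟩
    rintro d' v' ⟨-, s, hs, hd⟩
    simp only at hs hd
    obtain rfl : v' = v := value_eq_of_containsValue hR hL hs rfl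
    -- an honest broadcaster sends its proposal at time `0` only
    rw [bb_mem_sent_iff hR hL] at hs
    rcases hs.2.2 with ⟨-, rfl, -⟩ | ⟨-, _, -, h⟩ | ⟨_, -, _, -, h⟩ | ⟨-, _, h, -⟩
    · exact hd.ge
    · cases h
    · cases h
    · cases h
  have hex : ∃ v', FirstProposal L (R.history k (0 + R.delay L k 0 (.propose ⟨L, v⟩)))
      (0 + R.delay L k 0 (.propose ⟨L, v⟩)) v' := ⟨v, hfirst⟩
  refine ⟨0 + R.delay L k 0 (.propose ⟨L, v⟩), ?_, ?_, hex, ?_⟩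
  · linarith [hR.delay_nonneg _ _ _ _ hm]
  · linarith [hR.delay_le L hL k hk _ _ hm]
  · obtain ⟨-, s, hs, -⟩ := hex.choose_spec.1
    exact (value_eq_of_containsValue hR hL hs rfl).symm

/-- If the broadcaster is honest, the commit rule with parameter `δ` applies to its input: the votes
of all honest parties arrive by time `2δ ≤ Δ + δ`. -/
theorem commitRule_of_honest (hf : 2 * f < n) {v : V}
    (hR : (bbProtocol L f Δ hΔ A).IsExecution f δ (broadcastInput L v) R) (hL : L ∈ R.honest)
    (h0 : 0 ≤ δ) (hδ : δ ≤ Δ) {i : Fin n} (hi : i ∈ R.honest) :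
    CommitRule L f Δ (R.history i (δ + Δ)) δ v := by
  refine ⟨⟨h0, hδ⟩, ?_, ?_⟩
  · rintro ⟨v₁, v₂, hne, ⟨e, ⟨⟨-, s, hs, -⟩, -⟩, he⟩, ⟨e', ⟨⟨-, s', hs', -⟩, -⟩, he'⟩⟩
    exact hne ((value_eq_of_containsValue hR hL hs he).trans
      (value_eq_of_containsValue hR hL hs' he').symm)
  · have hcard : f + 1 ≤ R.honest.card := by
      have := hR.faulty_le
      rw [Finset.card_compl, Fintype.card_fin] at this
      omega
    obtain ⟨Q, hQ, hQc⟩ := Finset.exists_subset_card_eq hcard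
    refine ⟨Q, hQc, fun k hk => ?_⟩
    obtain ⟨d, hd0, hd, hvote⟩ := exists_votesFor hR hL (hQ hk)
    obtain ⟨e, ⟨he, he'⟩, hem⟩ := vote_received hR (hQ hk) hd0 (hd.trans hδ) hvote hi
    exact ⟨⟨k, d, ⟨L, v⟩⟩, rfl, rfl, hd0, hd, e, ⟨⟨by linarith, he'⟩, by linarith⟩, hem⟩

theorem bb_hasGoodCaseLatency (hf : 2 * f < n) (h0 : 0 ≤ δ) (hδ : δ ≤ Δ) :
    (bbProtocol L f Δ hΔ A).HasGoodCaseLatency L f δ (Δ + δ) := fun v _ hR hL _ hi =>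
  ⟨δ + Δ, some v, (add_comm δ Δ).le, (commitRule_of_honest hf hR hL h0 hδ hi).commits⟩

theorem bb_solvesBB (hf : 2 * f < n) (hA : A.SolvesBA f Δ) :
    (bbProtocol L f Δ hΔ A).SolvesBB L f Δ := fun _ _ _ h0 hδ hR =>
  ⟨fun _ hi _ hj _ _ _ _ hx hx' => bb_agreement hR hA h0 hδ hi hj hx hx',
    fun hL _ hi => ⟨⟨_, (commitRule_of_honest hf hR hL h0 hδ hi).commits⟩,
      (bb_termination hR hA h0 hδ hi).2⟩,
    fun _ hi => bb_termination hR hA h0 hδ hi⟩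

end Broadcast

end ByzantineBroadcast

open ByzantineBroadcast in
theorem mainTheorem6 {n f : ℕ} (hf : n < 3 * f) (hf' : 2 * f < n) {V : Type u} [Nontrivial V]
    (L : Fin n) (Δ : ℝ) (hΔ : 0 < Δ) :
    (∀ A : Protocol.{w} n (Option V) (Option V), A.SolvesBA f Δ →
      (bbProtocol L f Δ hΔ A).SolvesBB L f Δ ∧
        ∀ δ : ℝ, 0 ≤ δ → δ ≤ Δ → (bbProtocol L f Δ hΔ A).HasGoodCaseLatency L f δ (Δ + δ)) ∧
    (∀ P : Protocol.{w₁} n (Option V) (Option V), P.SolvesBB L f Δ →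
      ∀ δ : ℝ, 0 < δ → δ ≤ Δ → ∀ T : ℝ, P.HasGoodCaseLatency L f δ T → Δ + δ ≤ T) := by
  exact ⟨fun A hA => ⟨bb_solvesBB hf' hA, fun δ h0 hδ => bb_hasGoodCaseLatency hf' h0 hδ⟩,
    fun P hP δ hδ hδΔ T hT => le_of_hasGoodCaseLatency hf hf' hP hδ hδΔ hT⟩
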